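/- A subgroup $\Gamma$ of $SL(2,\mathbb{C})$ is said to have integral characteristic if, for every $g\in\Gamma$, the coefficients of the characteristic polynomial of $g$ are algebraic integers. Define families $\mathcal{H}_0,\mathcal{H}_1,\mathcal{H}_2,\dots$ of subgroups of $SL(2,\mathbb{C})$ as follows. The family $\mathcal{H}_0$ consists of all subgroups of integral characteristic. For $i\ge 1$, the family $\mathcal{H}_i$ consists of all subgroups $\Gamma$ of $SL(2,\mathbb{C})$ that admit an action by automorphisms, without inversions of edges, on some nonempty simplicial tree $T$ such that for every vertex $v$ of $T$ the isotropy group $\{g\in\Gamma : g v=v\}$ belongs to $\mathcal{H}_{i-1}$. Theorem. Every finitely generated subgroup of $SL(2,\mathbb{C})$ lies in $\bigcup_{i=0}^{\infty}\mathcal{H}_i$. -/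

import Mathlib

/-- A subgroup of `SL(n, ℂ)` has integral characteristic if all coefficients of the characteristic
polynomial of each of its elements are algebraic integers. -/
def HasIntegralCharacteristic {n : ℕ}
    (Γ : Subgroup (Matrix.SpecialLinearGroup (Fin n) ℂ)) : Prop :=
  ∀ g ∈ Γ, ∀ k : ℕ, IsIntegral ℤ ((g : Matrix (Fin n) (Fin n) ℂ).charpoly.coeff k)

/-- The subgroup `Γ` of `G` acts on some (nonempty, simplicial) tree by automorphisms and without
inversions, and the isotropy group of every vertex, regarded as a subgroup of `G`, belongs to the
family `F`. As there are no inversions, the isotropy group of any point of an edge is contained in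
that of an end of the edge. -/
def ActsOnTreeWithIsotropyIn {G : Type} [Group G] (F : Set (Subgroup G)) (Γ : Subgroup G) : Prop :=
  ∃ (V : Type) (T : SimpleGraph V) (_ : MulAction Γ V),
    T.IsTree ∧
    (∀ (g : Γ) (v w : V), T.Adj v w → T.Adj (g • v) (g • w)) ∧
    (∀ (g : Γ) (v w : V), T.Adj v w → ¬ (g • v = w ∧ g • w = v)) ∧
    ∀ v : V, (MulAction.stabilizer Γ v).map Γ.subtype ∈ F

/-- The hierarchy of families of subgroups of `SL(2, ℂ)`: at the bottom are the subgroups of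
integral characteristic, and each further level consists of the subgroups that act on a tree with
isotropy in the level below. -/
def treeHierarchy : ℕ → Set (Subgroup (Matrix.SpecialLinearGroup (Fin 2) ℂ))
  | 0 => {Γ | HasIntegralCharacteristic Γ}
  | i + 1 => {Γ | ActsOnTreeWithIsotropyIn (treeHierarchy i) Γ}

/-! Let `R` and `F` be the ring and the field generated by the matrix entries of a finite generating
set. Each discrete valuation of `F` gives a Bruhat-Tits tree on which SL₂(F) acts without
inversions. An element fixing a vertex is conjugate into GL₂ of the valuation ring, so its trace
lies in that ring (`exists_tree_of_isUniformizer`). Passing to vertex stabilizers for finitely many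
valuations in turn leaves groups whose traces are integral at all of them
(`mem_treeHierarchy_length`). Since determinants are 1, it suffices that the traces left at the end
are algebraic integers. They lie in `R`, so the crux is arithmetic: finitely many discrete
valuations of `F` detect integrality over ℤ for elements of `R`
(`Subring.exists_list_discrete_valuations`).

To find them, cover all valuation rings by finitely many Noetherian normal rings `C` with fraction
field `F`, in the manner of affine charts: every valuation ring contains some `C`
(`Subfield.exists_finite_isIntegrallyClosed_models`). With a common denominator `u` of the
generators of `R`, one has R ⊆ C[1/u], and an element of C[1/u] outside `C` has a pole at one of
finitely many discrete valuations attached to `u` (`exists_finite_discrete_valuations`). An element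
of `R` without such poles lies in every `C`, hence in every valuation ring, hence is integral over
ℤ. -/

/-! ### Trees from parent functions -/

/-- A graph in which adjacency is given by a parent function without periodic points, such that any
two vertices have a common ancestor, is a tree. -/
theorem SimpleGraph.isTree_of_parent {V : Type*} [Nonempty V] (T : SimpleGraph V) (p : V → V)
    (hadj : ∀ v w, T.Adj v w ↔ (w = p v ∨ v = p w))
    (hper : ∀ n v, p^[n + 1] v ≠ v)
    (hcom : ∀ v w, ∃ m n, p^[m] v = p^[n] w) : T.IsTree := by
  have hreach : ∀ n v, T.Reachable v (p^[n] v) := by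
    intro n
    induction n with
    | zero => intro v; rfl
    | succ n ih =>
      intro v
      rw [Function.iterate_succ_apply']
      exact (ih v).trans ((hadj _ _).2 (Or.inl rfl)).reachable
  refine ⟨⟨fun v w => ?_⟩, ?_⟩
  · obtain ⟨m, n, h⟩ := hcom v w
    exact (hreach m v).trans (h ▸ (hreach n w).symm)
  · have key : ∀ v, ¬ (T.deleteEdges {s(v, p v)}).Reachable v (p v) := by
      intro v ⟨W⟩
      -- Once the edge to `p v` is removed, a walk cannot leave the descendants of `v`; if it
      -- reached `p v`, then `v` would be periodic.
      have hD : ∀ {a b : V} (W : (T.deleteEdges {s(v, p v)}).Walk a b),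
          (∃ n, p^[n] a = v) → ∃ n, p^[n] b = v := by
        intro a b W
        induction W with
        | nil => exact id
        | @cons a b c hab _ ih =>
          rintro ⟨n, hn⟩
          apply ih
          rw [SimpleGraph.deleteEdges_adj, hadj] at hab
          obtain ⟨rfl | rfl, hne⟩ := hab
          · cases n with
            | zero => exact absurd (by rw [show a = v from hn]; rfl) hne
            | succ n => exact ⟨n, hn⟩
          · exact ⟨n + 1, hn⟩
      obtain ⟨n, hn⟩ := hD W ⟨0, rfl⟩
      exact hper n v hn
    rw [SimpleGraph.isAcyclic_iff_forall_adj_isBridge]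
    intro v w hvw
    rcases (hadj v w).1 hvw with rfl | rfl
    · rw [SimpleGraph.isBridge_iff]; exact key v
    · rw [Sym2.eq_swap, SimpleGraph.isBridge_iff]; exact key w

/-! ### Discrete valuation rings through a uniformizer -/

/-- `π` generates the maximal ideal of the discrete valuation subring `A` of the field `K`. -/
structure Subring.IsUniformizer {K : Type*} [Field K] (A : Subring K) (π : K) : Prop where
  ne_zero : π ≠ 0
  mem : π ∈ A
  inv_notMem : π⁻¹ ∉ A
  exists_zpow_mul : ∀ x : K, x ≠ 0 → ∃ (n : ℤ) (u : K), u ≠ 0 ∧ u ∈ A ∧ u⁻¹ ∈ A ∧ x = π ^ n * u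

namespace Subring.IsUniformizer

variable {K : Type*} [Field K] {A : Subring K} {π : K}

theorem zpow_mem_iff (h : A.IsUniformizer π) (n : ℤ) : π ^ n ∈ A ↔ 0 ≤ n := by
  constructor
  · intro hn
    by_contra! hlt
    apply h.inv_notMem
    have : π⁻¹ = π ^ n * π ^ (-n - 1).toNat := by
      rw [← zpow_natCast, Int.toNat_of_nonneg (by omega), ← zpow_add₀ h.ne_zero, ← zpow_neg_one]
      congr 1; ring
    rw [this]
    exact A.mul_mem hn (A.pow_mem h.mem _)
  · intro hn
    lift n to ℕ using hn
    exact_mod_cast A.pow_mem h.mem n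

theorem zpow_mul_mem_iff (h : A.IsUniformizer π) (n : ℤ) {u : K} (hu : u ≠ 0) (huA : u ∈ A)
    (huA' : u⁻¹ ∈ A) : π ^ n * u ∈ A ↔ 0 ≤ n := by
  rw [← h.zpow_mem_iff n]
  refine ⟨fun hn => ?_, fun hn => A.mul_mem hn huA⟩
  have := A.mul_mem hn huA'
  rwa [mul_assoc, mul_inv_cancel₀ hu, mul_one] at this

theorem mem_or_inv_mem (h : A.IsUniformizer π) (x : K) : x ∈ A ∨ x⁻¹ ∈ A := by
  rcases eq_or_ne x 0 with rfl | hx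
  · exact Or.inl A.zero_mem
  obtain ⟨n, u, hu, huA, huA', rfl⟩ := h.exists_zpow_mul x hx
  rcases le_total 0 n with hn | hn
  · exact Or.inl ((h.zpow_mul_mem_iff n hu huA huA').2 hn)
  · right
    rw [mul_inv, ← zpow_neg]
    exact A.mul_mem ((h.zpow_mem_iff _).2 (by omega)) huA'

theorem div_mem_or_inv_mem (h : A.IsUniformizer π) {x : K} (hx : x ∈ A) :
    x / π ∈ A ∨ (x ≠ 0 ∧ x⁻¹ ∈ A) := by
  rcases eq_or_ne x 0 with rfl | hx0
  · exact Or.inl (by simp [A.zero_mem])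
  obtain ⟨n, u, hu, huA, huA', rfl⟩ := h.exists_zpow_mul x hx0
  have hn := (h.zpow_mul_mem_iff n hu huA huA').1 hx
  rcases hn.eq_or_lt with rfl | hn
  · right; simpa [hu] using huA'
  · left
    have : π ^ n * u / π = π ^ (n - 1) * u := by rw [zpow_sub_one₀ h.ne_zero]; ring
    rw [this, h.zpow_mul_mem_iff _ hu huA huA']
    omega

theorem exists_pow_mul_mem (h : A.IsUniformizer π) (x : K) :
    ∃ k : ℕ, ∀ l : ℕ, k ≤ l → π ^ l * x ∈ A := by
  rcases eq_or_ne x 0 with rfl | hx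
  · exact ⟨0, fun l _ => by simp [A.zero_mem]⟩
  obtain ⟨n, u, hu, huA, huA', rfl⟩ := h.exists_zpow_mul x hx
  refine ⟨n.natAbs, fun l hl => ?_⟩
  rw [← mul_assoc, ← zpow_natCast, ← zpow_add₀ h.ne_zero, h.zpow_mul_mem_iff _ hu huA huA']
  omega

end Subring.IsUniformizer

/-! ### The Bruhat-Tits tree of SL₂ -/

namespace BruhatTits

open Matrix

variable {K : Type*} [Field K]

/-- The subgroup `Kˣ · GL₂(A)` of `GL₂(K)`. -/
def homothetyStabilizer (A : Subring K) : Subgroup (GL (Fin 2) K) where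
  -- The determinant of `c * g` is in `A` because the entries are; the last condition makes it a
  -- unit, so that `c * g` is in GL₂(A).
  carrier := {g | ∃ c : K, c ≠ 0 ∧ (∀ i j, c * g i j ∈ A) ∧ (c ^ 2 * g.1.det)⁻¹ ∈ A}
  one_mem' := by
    refine ⟨1, one_ne_zero, fun i j => ?_, by simp [A.one_mem]⟩
    rw [one_mul, Units.val_one, Matrix.one_apply]
    split_ifs
    exacts [A.one_mem, A.zero_mem]
  mul_mem' := by
    rintro g g' ⟨c, hc, hg, hd⟩ ⟨c', hc', hg', hd'⟩
    refine ⟨c * c', mul_ne_zero hc hc', fun i j => ?_, ?_⟩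
    · rw [Units.val_mul, Matrix.mul_apply, Finset.mul_sum]
      refine A.sum_mem fun k _ => ?_
      have := A.mul_mem (hg i k) (hg' k j)
      rwa [show c * g i k * (c' * g' k j) = c * c' * (g i k * g' k j) by ring] at this
    · have := A.mul_mem hd hd'
      rw [Units.val_mul, Matrix.det_mul]
      rwa [← mul_inv, show c ^ 2 * g.1.det * (c' ^ 2 * g'.1.det) =
        (c * c') ^ 2 * (g.1.det * g'.1.det) by ring] at this
  inv_mem' := by
    rintro g ⟨c, hc, hg, hd⟩
    have hg0 : g.1.det ≠ 0 := g.det_ne_zero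
    refine ⟨c⁻¹, inv_ne_zero hc, fun i j => ?_, ?_⟩
    · have : c⁻¹ * (g⁻¹ : GL (Fin 2) K) i j = (c * g.1.adjugate i j) * (c ^ 2 * g.1.det)⁻¹ := by
        rw [Matrix.coe_units_inv, Matrix.inv_def, Matrix.smul_apply, Ring.inverse_eq_inv',
          smul_eq_mul]
        field_simp
      rw [this]
      refine A.mul_mem ?_ hd
      rw [Matrix.adjugate_fin_two]
      fin_cases i <;> fin_cases j <;> simp [hg]
    · have : (c⁻¹ ^ 2 * ((g⁻¹ : GL (Fin 2) K) : Matrix (Fin 2) (Fin 2) K).det)⁻¹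
          = (c * g 0 0) * (c * g 1 1) - (c * g 0 1) * (c * g 1 0) := by
        rw [Matrix.coe_units_inv, Matrix.det_nonsing_inv, Ring.inverse_eq_inv', inv_pow,
          ← mul_inv, inv_inv, Matrix.det_fin_two]
        ring
      rw [this]
      exact A.sub_mem (A.mul_mem (hg _ _) (hg _ _)) (A.mul_mem (hg _ _) (hg _ _))

/-- The vertices of the Bruhat-Tits tree. -/
abbrev Vertex (A : Subring K) := GL (Fin 2) K ⧸ homothetyStabilizer A

/-- The vertex given by an invertible matrix. -/
abbrev mk (A : Subring K) (g : GL (Fin 2) K) : Vertex A := QuotientGroup.mk g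

/-- The matrix with rows `(a, b)` and `(0, 1)`. -/
def tri (a : Kˣ) (b : K) : GL (Fin 2) K :=
  Matrix.GeneralLinearGroup.mkOfDetNeZero !![(a : K), b; 0, 1] (by simp [Matrix.det_fin_two])

theorem coe_tri (a : Kˣ) (b : K) : (tri a b : Matrix (Fin 2) (Fin 2) K) = !![(a : K), b; 0, 1] :=
  rfl

theorem tri_mul_tri (a a' : Kˣ) (b b' : K) : tri a b * tri a' b' = tri (a * a') (a * b' + b) := by
  apply Units.ext
  simp [coe_tri, Units.val_mul]

theorem mk_eq_mk_of_eq_mul {A : Subring K} {g g' : GL (Fin 2) K} (M : Matrix (Fin 2) (Fin 2) K)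
    (hM : g'.1 = g.1 * M) (c : K) (hc : c ≠ 0) (h1 : ∀ i j, c * M i j ∈ A)
    (h2 : (c ^ 2 * M.det)⁻¹ ∈ A) : mk A g = mk A g' := by
  rw [QuotientGroup.eq]
  have : ((g⁻¹ * g' : GL (Fin 2) K) : Matrix (Fin 2) (Fin 2) K) = M := by
    rw [Units.val_mul, hM, ← Matrix.mul_assoc, ← Units.val_mul, inv_mul_cancel, Units.val_one,
      Matrix.one_mul]
  exact ⟨c, hc, by rwa [this], by rwa [this]⟩

/-- Think of `tri a b` as the ball `b + aA`: two balls agree when the radii differ by a unit and the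
centres by an element of `aA`. -/
theorem mk_tri_eq_mk_tri_iff {A : Subring K} (a a' : Kˣ) (b b' : K) :
    mk A (tri a b) = mk A (tri a' b') ↔
      (a' / a : K) ∈ A ∧ (a / a' : K) ∈ A ∧ (b' - b) / a ∈ A := by
  have ha : (a : K) ≠ 0 := a.ne_zero
  have ha' : (a' : K) ≠ 0 := a'.ne_zero
  constructor
  · intro h
    rw [QuotientGroup.eq] at h
    have e : (tri a b)⁻¹ * tri a' b' = tri (a⁻¹ * a') ((b' - b) / a) := by
      rw [inv_mul_eq_iff_eq_mul, tri_mul_tri]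
      congr 1
      · simp
      · field_simp; ring
    rw [e] at h
    obtain ⟨c, hc, h1, h2⟩ := h
    rw [coe_tri] at h1 h2
    have h00 := h1 0 0
    have h01 := h1 0 1
    have h11 := h1 1 1
    simp only [Units.val_mul, Units.val_inv_eq_inv_val, Matrix.of_apply, Matrix.cons_val',
      Matrix.cons_val_zero, Matrix.cons_val_one, Matrix.cons_val_fin_one, mul_one, mul_zero,
      sub_zero, Matrix.det_fin_two] at h00 h01 h11 h2
    have hci : c⁻¹ ∈ A := by
      have := A.mul_mem h00 h2
      rwa [show c * ((a : K)⁻¹ * a') * (c ^ 2 * ((a : K)⁻¹ * a'))⁻¹ = c⁻¹ by field_simp] at this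
    refine ⟨?_, ?_, ?_⟩
    · have := A.mul_mem h00 hci
      rwa [show c * ((a : K)⁻¹ * a') * c⁻¹ = a' / a by field_simp] at this
    · have := A.mul_mem (A.mul_mem h11 h11) h2
      rwa [show c * c * (c ^ 2 * ((a : K)⁻¹ * a'))⁻¹ = a / a' by field_simp] at this
    · have := A.mul_mem h01 hci
      rwa [show c * ((b' - b) / a) * c⁻¹ = (b' - b) / a by field_simp] at this
  · rintro ⟨h1, h2, h3⟩
    refine mk_eq_mk_of_eq_mul !![(a' / a : K), (b' - b) / a; 0, 1] ?_ 1 one_ne_zero ?_ ?_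
    · rw [coe_tri, coe_tri, Matrix.mul_fin_two]
      congr 1
      ext i j
      fin_cases i <;> fin_cases j <;> simp <;> field_simp <;> ring
    · intro i j
      fin_cases i <;> fin_cases j <;> simp [h1, h3, A.one_mem, A.zero_mem]
    · simpa [Matrix.det_fin_two] using h2

/-- Column reduction over `A` with pivot `g 1 1`: clear the other entry of the bottom row, then
rescale by a homothety. The primed version swaps the columns (with a sign) to use the pivot `g 1 0`.
-/
theorem mk_eq_mk_tri_of_div_mem {A : Subring K} (g : GL (Fin 2) K) (hs : g 1 1 ≠ 0)
    (h : g 1 0 / g 1 1 ∈ A) (a : Kˣ) (ha : (a : K) = g.1.det / g 1 1 ^ 2) :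
    mk A g = mk A (tri a (g 0 1 / g 1 1)) := by
  have hg0 : g.1.det ≠ 0 := g.det_ne_zero
  refine mk_eq_mk_of_eq_mul !![(g 1 1)⁻¹, 0; - (g 1 0 / g 1 1 ^ 2), (g 1 1)⁻¹] ?_ (g 1 1) hs ?_ ?_
  · rw [coe_tri, ha, Matrix.det_fin_two]
    ext i j
    fin_cases i <;> fin_cases j <;> simp [Matrix.mul_apply, Fin.sum_univ_two] <;> field_simp <;> ring
  · have : -(g 1 1 * (g 1 0 / g 1 1 ^ 2)) ∈ A := by
      convert A.neg_mem h using 2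
      field_simp
    intro i j
    fin_cases i <;> fin_cases j <;> simp [hs, A.one_mem, A.zero_mem, this]
  · simp [Matrix.det_fin_two]
    convert A.one_mem
    field_simp

theorem mk_eq_mk_tri_of_div_mem' {A : Subring K} (g : GL (Fin 2) K) (hr : g 1 0 ≠ 0)
    (h : g 1 1 / g 1 0 ∈ A) (a : Kˣ) (ha : (a : K) = g.1.det / g 1 0 ^ 2) :
    mk A g = mk A (tri a (g 0 0 / g 1 0)) := by
  have hg0 : g.1.det ≠ 0 := g.det_ne_zero
  refine mk_eq_mk_of_eq_mul !![(g 1 1 / g 1 0 ^ 2), (g 1 0)⁻¹; -(g 1 0)⁻¹, 0] ?_ (g 1 0) hr ?_ ?_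
  · rw [coe_tri, ha, Matrix.det_fin_two]
    ext i j
    fin_cases i <;> fin_cases j <;> simp [Matrix.mul_apply, Fin.sum_univ_two] <;> field_simp <;> ring
  · have : g 1 0 * (g 1 1 / g 1 0 ^ 2) ∈ A := by
      convert h using 1
      field_simp
    intro i j
    fin_cases i <;> fin_cases j <;> simp [hr, A.one_mem, A.zero_mem, this]
  · simp [Matrix.det_fin_two]
    convert A.one_mem
    field_simp

variable {A : Subring K} {π : K}

/-- Of the two ratios of the bottom entries one lies in `A`, and this decides which entry serves as
pivot. -/
theorem exists_mk_tri (hπ : A.IsUniformizer π) (v : Vertex A) : ∃ a b, v = mk A (tri a b) := by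
  obtain ⟨g, rfl⟩ := QuotientGroup.mk_surjective v
  have hg0 : g.1.det ≠ 0 := g.det_ne_zero
  by_cases hs : g 1 1 ≠ 0 ∧ g 1 0 / g 1 1 ∈ A
  · exact ⟨Units.mk0 (g.1.det / g 1 1 ^ 2) (by simp [hg0, hs.1]), _,
      mk_eq_mk_tri_of_div_mem g hs.1 hs.2 _ rfl⟩
  · have hr : g 1 0 ≠ 0 ∧ g 1 1 / g 1 0 ∈ A := by
      by_cases h11 : g 1 1 = 0
      · rw [Matrix.det_fin_two, h11] at hg0
        refine ⟨fun h => hg0 (by simp [h]), by simp [h11, A.zero_mem]⟩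
      · have h2 : g 1 0 / g 1 1 ∉ A := fun h => hs ⟨h11, h⟩
        refine ⟨fun h => h2 (by simp [h, A.zero_mem]), ?_⟩
        rw [← inv_div]
        exact (hπ.mem_or_inv_mem _).resolve_left h2
    exact ⟨Units.mk0 (g.1.det / g 1 0 ^ 2) (by simp [hg0, hr.1]), _,
      mk_eq_mk_tri_of_div_mem' g hr.1 hr.2 _ rfl⟩

/-- A uniformizer as a unit of the field. -/
def unif (hπ : A.IsUniformizer π) : Kˣ := Units.mk0 π hπ.ne_zero

/-- The neighbour of a vertex in the direction of the end fixed by the upper triangular matrices.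
-/
noncomputable def parent (hπ : A.IsUniformizer π) (v : Vertex A) : Vertex A :=
  mk A (tri ((exists_mk_tri hπ v).choose * (unif hπ)⁻¹) (exists_mk_tri hπ v).choose_spec.choose)

/-- The parent of a ball is the ball one size larger around it, which does not depend on the centre
and radius chosen to describe the smaller one. -/
theorem parent_mk_tri (hπ : A.IsUniformizer π) (a : Kˣ) (b : K) :
    parent hπ (mk A (tri a b)) = mk A (tri (a * (unif hπ)⁻¹) b) := by
  have h := (exists_mk_tri hπ (mk A (tri a b))).choose_spec.choose_spec
  rw [parent]
  generalize (exists_mk_tri hπ (mk A (tri a b))).choose_spec.choose = b' at *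
  generalize (exists_mk_tri hπ (mk A (tri a b))).choose = a' at *
  rw [eq_comm, mk_tri_eq_mk_tri_iff]
  rw [mk_tri_eq_mk_tri_iff] at h
  have hu : ((unif hπ : Kˣ) : K) = π := rfl
  have h0 := hπ.ne_zero
  have ha : (a : K) ≠ 0 := a.ne_zero
  have ha' : (a' : K) ≠ 0 := a'.ne_zero
  simp only [Units.val_mul, Units.val_inv_eq_inv_val, hu]
  refine ⟨?_, ?_, ?_⟩
  · convert h.1 using 1; field_simp
  · convert h.2.1 using 1; field_simp
  · convert A.mul_mem h.2.2 hπ.mem using 1; field_simp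

theorem iterate_parent_mk_tri (hπ : A.IsUniformizer π) (a : Kˣ) (b : K) (n : ℕ) :
    (parent hπ)^[n] (mk A (tri a b)) = mk A (tri (a * (unif hπ)⁻¹ ^ n) b) := by
  induction n with
  | zero => simp
  | succ n ih => rw [Function.iterate_succ_apply', ih, parent_mk_tri, mul_assoc, ← pow_succ]

/-- Each step lowers the valuation of the radius by one. -/
theorem iterate_parent_ne (hπ : A.IsUniformizer π) (n : ℕ) (v : Vertex A) :
    (parent hπ)^[n + 1] v ≠ v := by
  obtain ⟨a, b, rfl⟩ := exists_mk_tri hπ v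
  rw [iterate_parent_mk_tri, Ne, mk_tri_eq_mk_tri_iff]
  rintro ⟨-, h, -⟩
  have e : ((a * (unif hπ)⁻¹ ^ (n + 1) : Kˣ) : K) / a = π ^ (-(n + 1 : ℤ)) := by
    have h0 := hπ.ne_zero
    have : ((unif hπ : Kˣ) : K) = π := rfl
    rw [_root_.zpow_neg, Units.val_mul, mul_div_cancel_left₀ _ a.ne_zero, Units.val_pow_eq_pow_val,
      Units.val_inv_eq_inv_val, this, inv_pow]
    norm_cast
  rw [e, hπ.zpow_mem_iff] at h
  omega

theorem exists_common_ancestor (hπ : A.IsUniformizer π) (v w : Vertex A) :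
    ∃ m n, (parent hπ)^[m] v = (parent hπ)^[n] w := by
  obtain ⟨a, b, rfl⟩ := exists_mk_tri hπ v
  obtain ⟨a', b', rfl⟩ := exists_mk_tri hπ w
  have ha : (a : K) ≠ 0 := a.ne_zero
  have ha' : (a' : K) ≠ 0 := a'.ne_zero
  have h0 := hπ.ne_zero
  have hu0 : ((unif hπ : Kˣ) : K) = π := rfl
  obtain ⟨k, hk⟩ := hπ.exists_pow_mul_mem ((b' - b) / a)
  obtain ⟨n, u, hu, huA, huA', e⟩ := hπ.exists_zpow_mul ((a' : K) / a) (div_ne_zero ha' ha)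
  -- Enlarging the first ball `m = k + |n|` times makes it contain `b'`; then `l = m + n`
  -- enlargements of the second give the same radius up to a unit. The summand `|n|` keeps `l`
  -- nonnegative.
  obtain ⟨l, hl⟩ : ∃ l : ℕ, (l : ℤ) = (k + n.natAbs : ℕ) + n :=
    ⟨((k + n.natAbs : ℕ) + n).toNat, Int.toNat_of_nonneg (by omega)⟩
  refine ⟨k + n.natAbs, l, ?_⟩
  set m := k + n.natAbs with hm
  have e' : (a' : K) / a * π ^ m / π ^ l = u := by
    rw [e, ← zpow_natCast π l, hl, zpow_add₀ h0, zpow_natCast]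
    field_simp
  rw [iterate_parent_mk_tri, iterate_parent_mk_tri, mk_tri_eq_mk_tri_iff]
  simp only [Units.val_mul, Units.val_inv_eq_inv_val, Units.val_pow_eq_pow_val, hu0, inv_pow]
  refine ⟨?_, ?_, ?_⟩
  · convert huA using 1; rw [← e']; field_simp
  · convert huA' using 1; rw [← e']; field_simp
  · convert hk m (by omega) using 1; field_simp

/-- The Bruhat-Tits tree of `SL₂(K)` for a discrete valuation of `K`. -/
def tree (hπ : A.IsUniformizer π) : SimpleGraph (Vertex A) where
  Adj v w := w = parent hπ v ∨ v = parent hπ w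
  symm := ⟨fun _ _ h => h.symm⟩
  loopless := ⟨fun v h => iterate_parent_ne hπ 0 v (by simpa [eq_comm] using h)⟩

theorem isTree_tree (hπ : A.IsUniformizer π) : (tree hπ).IsTree :=
  haveI : Nonempty (Vertex A) := ⟨mk A 1⟩
  SimpleGraph.isTree_of_parent _ (parent hπ) (fun _ _ => Iff.rfl) (iterate_parent_ne hπ)
    (exists_common_ancestor hπ)

/-- The stabilizer of the base vertex moves the parent of that vertex only to neighbours. If the
lower left entry of `c * h` is divisible by `π`, the parent is fixed; if it is a unit, the image is
a child `b + πA` with `b ∈ A`. -/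
theorem mk_mul_tri_inv (hπ : A.IsUniformizer π) {h : GL (Fin 2) K}
    (hh : h ∈ homothetyStabilizer A) :
    mk A (h * tri (unif hπ)⁻¹ 0) = mk A (tri (unif hπ)⁻¹ 0) ∨
      ∃ b ∈ A, mk A (h * tri (unif hπ)⁻¹ 0) = mk A (tri (unif hπ) b) := by
  obtain ⟨c, hc, h1, h2⟩ := hh
  have h0 := hπ.ne_zero
  have hu0 : ((unif hπ : Kˣ) : K) = π := rfl
  have hdet0 : h.1.det ≠ 0 := h.det_ne_zero
  have hdetA : c ^ 2 * h.1.det ∈ A := by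
    have := A.sub_mem (A.mul_mem (h1 0 0) (h1 1 1)) (A.mul_mem (h1 0 1) (h1 1 0))
    rw [Matrix.det_fin_two]
    convert this using 1; ring
  have hcoe : ((h * tri (unif hπ)⁻¹ 0 : GL (Fin 2) K) : Matrix (Fin 2) (Fin 2) K)
      = !![h 0 0 / π, h 0 1; h 1 0 / π, h 1 1] := by
    rw [Units.val_mul, coe_tri]
    ext i j
    fin_cases i <;> fin_cases j <;>
      simp [Matrix.mul_apply, Fin.sum_univ_two, hu0, div_eq_mul_inv]
  have hdet : ((h * tri (unif hπ)⁻¹ 0 : GL (Fin 2) K) : Matrix (Fin 2) (Fin 2) K).det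
      = h.1.det / π := by
    rw [hcoe, Matrix.det_fin_two, Matrix.det_fin_two]; simp; ring
  have e00 : (h * tri (unif hπ)⁻¹ 0) 0 0 = h 0 0 / π := by rw [hcoe]; rfl
  have e01 : (h * tri (unif hπ)⁻¹ 0) 0 1 = h 0 1 := by rw [hcoe]; rfl
  have e10 : (h * tri (unif hπ)⁻¹ 0) 1 0 = h 1 0 / π := by rw [hcoe]; rfl
  have e11 : (h * tri (unif hπ)⁻¹ 0) 1 1 = h 1 1 := by rw [hcoe]; rfl
  rcases hπ.div_mem_or_inv_mem (h1 1 0) with hr | ⟨hr0, hr⟩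
  · left
    have hs : c * h 1 1 ≠ 0 ∧ (c * h 1 1)⁻¹ ∈ A := by
      rcases hπ.div_mem_or_inv_mem (h1 1 1) with hs | hs
      -- If `π` divided the whole bottom row of `c * h`, it would divide its determinant, which is a
      -- unit.
      · exfalso
        apply hπ.inv_notMem
        have := A.mul_mem (A.sub_mem (A.mul_mem (h1 0 0) hs) (A.mul_mem (h1 0 1) hr)) h2
        convert this using 1
        rw [Matrix.det_fin_two] at hdet0 ⊢
        field_simp
      · exact hs
    have hs0 : h 1 1 ≠ 0 := fun h' => hs.1 (by simp [h'])
    rw [mk_eq_mk_tri_of_div_mem (h * tri (unif hπ)⁻¹ 0) (by rwa [e11])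
      (by rw [e10, e11]; convert A.mul_mem hr hs.2 using 1; field_simp)
      (Units.mk0 (h.1.det / π / h 1 1 ^ 2) (by simp [hdet0, h0, hs0]))
      (by rw [hdet, e11]; rfl), mk_tri_eq_mk_tri_iff, e01, e11]
    simp only [Units.val_inv_eq_inv_val, hu0, Units.val_mk0]
    refine ⟨?_, ?_, ?_⟩
    · convert A.mul_mem (A.mul_mem (h1 1 1) (h1 1 1)) h2 using 1; field_simp
    · convert A.mul_mem (A.mul_mem hs.2 hs.2) hdetA using 1; field_simp
    · convert A.mul_mem (A.mul_mem (A.mul_mem (A.neg_mem (h1 0 1)) (h1 1 1)) h2) hπ.mem using 1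
      field_simp; ring
  · right
    have hr1 : h 1 0 ≠ 0 := fun h' => hr0 (by simp [h'])
    refine ⟨h 0 0 / h 1 0, by convert A.mul_mem (h1 0 0) hr using 1; field_simp, ?_⟩
    rw [mk_eq_mk_tri_of_div_mem' (h * tri (unif hπ)⁻¹ 0) (by rw [e10]; simp [hr1, h0])
      (by rw [e10, e11]; convert A.mul_mem (A.mul_mem (h1 1 1) hr) hπ.mem using 1; field_simp)
      (Units.mk0 (h.1.det / π / (h 1 0 / π) ^ 2) (by simp [hdet0, h0, hr1]))
      (by rw [hdet, e10]; rfl), mk_tri_eq_mk_tri_iff, e00, e10]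
    simp only [hu0, Units.val_mk0]
    refine ⟨?_, ?_, ?_⟩
    · convert A.mul_mem (A.mul_mem (h1 1 0) (h1 1 0)) h2 using 1; field_simp
    · convert A.mul_mem (A.mul_mem hr hr) hdetA using 1; field_simp
    · convert A.zero_mem using 1; field_simp; simp

theorem tree_adj_mk_mul (hπ : A.IsUniformizer π) (g : GL (Fin 2) K) :
    (tree hπ).Adj (mk A g) (mk A (g * tri (unif hπ)⁻¹ 0)) := by
  obtain ⟨a, b, hab⟩ := exists_mk_tri hπ (mk A g)
  obtain ⟨h, hh, rfl⟩ : ∃ h ∈ homothetyStabilizer A, g = tri a b * h :=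
    ⟨_, QuotientGroup.eq.1 hab.symm, by group⟩
  have smul_mk : ∀ x, mk A (tri a b * x) = tri a b • mk A x := fun _ => rfl
  rw [hab, mul_assoc, smul_mk]
  rcases mk_mul_tri_inv hπ hh with e | ⟨b', hb', e⟩
  · left
    rw [e, parent_mk_tri, ← smul_mk, tri_mul_tri]
    simp
  · right
    rw [e, ← smul_mk, tri_mul_tri, parent_mk_tri, mk_tri_eq_mk_tri_iff]
    have ha : (a : K) ≠ 0 := a.ne_zero
    refine ⟨?_, ?_, ?_⟩
    · simp [A.one_mem]
    · simp [A.one_mem]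
    · simpa using hb'

/-- `parent` singles out an end and is not equivariant under GL₂(K); this description of adjacency
is visibly invariant under left multiplication. -/
theorem tree_adj_iff (hπ : A.IsUniformizer π) (v w : Vertex A) :
    (tree hπ).Adj v w ↔ ∃ g, (v = mk A g ∧ w = mk A (g * tri (unif hπ)⁻¹ 0)) ∨
      (w = mk A g ∧ v = mk A (g * tri (unif hπ)⁻¹ 0)) := by
  have key : ∀ v, ∃ g, v = mk A g ∧ parent hπ v = mk A (g * tri (unif hπ)⁻¹ 0) := by
    intro v
    obtain ⟨a, b, rfl⟩ := exists_mk_tri hπ v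
    exact ⟨_, rfl, by rw [parent_mk_tri, tri_mul_tri]; simp⟩
  constructor
  · rintro (rfl | rfl)
    · obtain ⟨g, hg⟩ := key v
      exact ⟨g, Or.inl hg⟩
    · obtain ⟨g, hg⟩ := key w
      exact ⟨g, Or.inr hg⟩
  · rintro ⟨g, ⟨rfl, rfl⟩ | ⟨rfl, rfl⟩⟩
    · exact tree_adj_mk_mul hπ g
    · exact (tree_adj_mk_mul hπ g).symm

theorem tree_adj_smul (hπ : A.IsUniformizer π) (g : GL (Fin 2) K) {v w : Vertex A}
    (h : (tree hπ).Adj v w) : (tree hπ).Adj (g • v) (g • w) := by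
  rw [tree_adj_iff] at h ⊢
  obtain ⟨x, ⟨rfl, rfl⟩ | ⟨rfl, rfl⟩⟩ := h
  · exact ⟨g * x, Or.inl ⟨rfl, by rw [mul_assoc]; rfl⟩⟩
  · exact ⟨g * x, Or.inr ⟨rfl, by rw [mul_assoc]; rfl⟩⟩

/-- Determinants in Kˣ · GL₂(A) have even valuation. -/
theorem det_ne_inv (hπ : A.IsUniformizer π) {h : GL (Fin 2) K}
    (hh : h ∈ homothetyStabilizer A) : h.1.det ≠ π⁻¹ := by
  obtain ⟨c, hc, h1, h2⟩ := hh
  intro hdet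
  have hdetA : c ^ 2 * h.1.det ∈ A := by
    have := A.sub_mem (A.mul_mem (h1 0 0) (h1 1 1)) (A.mul_mem (h1 0 1) (h1 1 0))
    rw [Matrix.det_fin_two]
    convert this using 1; ring
  obtain ⟨n, u, hu, huA, huA', rfl⟩ := hπ.exists_zpow_mul c hc
  have h0 := hπ.ne_zero
  have e1 : (π ^ n * u) ^ 2 * h.1.det = π ^ (2 * n - 1) * u ^ 2 := by
    rw [hdet, zpow_sub_one₀ h0, two_mul, zpow_add₀ h0]; ring
  have e2 : ((π ^ n * u) ^ 2 * h.1.det)⁻¹ = π ^ (-(2 * n - 1)) * u⁻¹ ^ 2 := by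
    rw [e1, mul_inv, ← _root_.zpow_neg, inv_pow]
  rw [e1, hπ.zpow_mul_mem_iff _ (pow_ne_zero _ hu) (A.pow_mem huA _)
    (by rw [← inv_pow]; exact A.pow_mem huA' _)] at hdetA
  rw [e2, hπ.zpow_mul_mem_iff _ (pow_ne_zero _ (inv_ne_zero hu)) (A.pow_mem huA' _)
    (by rw [← inv_pow, inv_inv]; exact A.pow_mem huA _)] at h2
  omega

/-- A conjugate of `g` lies in Kˣ · GL₂(A). As its determinant is 1, the homothety factor has unit
square and is itself a unit, so the conjugate has entries in `A`. -/
theorem trace_mem_of_smul_eq (hπ : A.IsUniformizer π) {g : GL (Fin 2) K} (hg : g.1.det = 1)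
    {v : Vertex A} (h : g • v = v) : g.1.trace ∈ A := by
  obtain ⟨x, rfl⟩ := QuotientGroup.mk_surjective v
  have hh : x⁻¹ * (g * x) ∈ homothetyStabilizer A := QuotientGroup.eq.1 h.symm
  have htr : (x⁻¹ * (g * x)).1.trace = g.1.trace := by
    rw [Units.val_mul, Units.val_mul, Matrix.trace_mul_comm, Matrix.mul_assoc, ← Units.val_mul,
      mul_inv_cancel, Units.val_one, Matrix.mul_one]
  have hdet : (x⁻¹ * (g * x)).1.det = 1 := by
    rw [Units.val_mul, Units.val_mul, Matrix.det_mul, Matrix.det_mul, hg, one_mul,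
      ← Matrix.det_mul, ← Units.val_mul, inv_mul_cancel, Units.val_one, Matrix.det_one]
  rw [← htr]
  generalize x⁻¹ * (g * x) = y at *
  obtain ⟨c, hc, h1, h2⟩ := hh
  rw [hdet, mul_one] at h2
  have hci : c⁻¹ ∈ A := by
    rcases hπ.mem_or_inv_mem c with h | h
    · convert A.mul_mem h h2 using 1; field_simp
    · exact h
  rw [Matrix.trace_fin_two]
  convert A.mul_mem (A.add_mem (h1 0 0) (h1 1 1)) hci using 1
  field_simp

/-- Adjacent vertices have types of opposite parity, measured by the valuation of the determinant,
and determinant 1 preserves the type. Hence `g` cannot even move a vertex to a neighbour. -/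
theorem not_inversion (hπ : A.IsUniformizer π) {g : GL (Fin 2) K} (hg : g.1.det = 1)
    {v w : Vertex A} (hvw : (tree hπ).Adj v w) : ¬ (g • v = w ∧ g • w = v) := by
  rintro ⟨h1, h2⟩
  have key : ∀ x, g • mk A x ≠ mk A (x * tri (unif hπ)⁻¹ 0) := by
    intro x hx
    have hh : (g * x)⁻¹ * (x * tri (unif hπ)⁻¹ 0) ∈ homothetyStabilizer A := QuotientGroup.eq.1 hx
    have hg' : (g⁻¹ : GL (Fin 2) K).1.det = 1 := by
      rw [Matrix.coe_units_inv, Matrix.det_nonsing_inv, hg, Ring.inverse_one]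
    refine det_ne_inv hπ hh ?_
    rw [_root_.mul_inv_rev, mul_assoc, ← mul_assoc g⁻¹]
    rw [Units.val_mul, Units.val_mul, Units.val_mul, Matrix.det_mul, Matrix.det_mul,
      Matrix.det_mul, hg', one_mul, ← mul_assoc, ← Matrix.det_mul, ← Units.val_mul,
      inv_mul_cancel, Units.val_one, Matrix.det_one, one_mul, coe_tri, Matrix.det_fin_two]
    simp [unif]
  rw [tree_adj_iff] at hvw
  obtain ⟨x, ⟨rfl, rfl⟩ | ⟨rfl, rfl⟩⟩ := hvw
  · exact key x h1
  · exact key x h2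

end BruhatTits

/-- A group that is mapped to `SL₂` of a field with a discrete valuation acts without inversions on
a tree such that the elements of the vertex stabilizers have traces in the valuation ring. -/
theorem exists_tree_of_isUniformizer {K : Type} [Field K] {A : Subring K} {π : K}
    (hπ : A.IsUniformizer π) {Γ : Type*} [Group Γ]
    (φ : Γ →* Matrix.SpecialLinearGroup (Fin 2) K) :
    ∃ (V : Type) (T : SimpleGraph V) (_ : MulAction Γ V), T.IsTree ∧
      (∀ (g : Γ) (v w : V), T.Adj v w → T.Adj (g • v) (g • w)) ∧
      (∀ (g : Γ) (v w : V), T.Adj v w → ¬ (g • v = w ∧ g • w = v)) ∧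
      ∀ v : V, ∀ g ∈ MulAction.stabilizer Γ v, (φ g).1.trace ∈ A := by
  let ψ : Γ →* GL (Fin 2) K := Matrix.SpecialLinearGroup.toGL.comp φ
  have hdet : ∀ g, (ψ g).1.det = 1 := fun g => (φ g).2
  refine ⟨BruhatTits.Vertex A, BruhatTits.tree hπ, MulAction.compHom _ ψ,
    BruhatTits.isTree_tree hπ, ?_, ?_, ?_⟩
  · intro g v w h
    exact BruhatTits.tree_adj_smul hπ (ψ g) h
  · intro g v w h
    exact BruhatTits.not_inversion hπ (hdet g) h
  · intro v g hg
    exact BruhatTits.trace_mem_of_smul_eq hπ (hdet g) hg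

/-! ### Discrete valuations on Noetherian normal domains -/

theorem IsDiscreteValuationRing.isUniformizer_range {R K : Type*} [CommRing R] [IsDomain R]
    [IsDiscreteValuationRing R] [Field K] [Algebra R K] [IsFractionRing R K] {ϖ : R}
    (hϖ : Irreducible ϖ) : (algebraMap R K).range.IsUniformizer (algebraMap R K ϖ) where
  ne_zero := by simpa using hϖ.ne_zero
  mem := ⟨ϖ, rfl⟩
  inv_notMem := by
    rintro ⟨y, hy⟩
    refine hϖ.not_isUnit (IsUnit.of_mul_eq_one y (IsFractionRing.injective R K ?_))
    rw [map_mul, hy, map_one, mul_inv_cancel₀]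
    simpa using hϖ.ne_zero
  exists_zpow_mul := by
    intro x hx
    obtain ⟨a, b, hb, rfl⟩ := IsFractionRing.div_surjective R x
    have ha0 : a ≠ 0 := by rintro rfl; simp at hx
    have hb0 : b ≠ 0 := nonZeroDivisors.ne_zero hb
    have hϖ0 : algebraMap R K ϖ ≠ 0 := by simpa using hϖ.ne_zero
    obtain ⟨m, u, rfl⟩ := IsDiscreteValuationRing.eq_unit_mul_pow_irreducible ha0 hϖ
    obtain ⟨n, v, rfl⟩ := IsDiscreteValuationRing.eq_unit_mul_pow_irreducible hb0 hϖ
    have hinv : ∀ w : Rˣ, algebraMap R K (w⁻¹ : Rˣ) = (algebraMap R K w)⁻¹ := fun w => by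
      apply eq_inv_of_mul_eq_one_left
      rw [← map_mul]; simp
    refine ⟨m - n, algebraMap R K (u * v⁻¹ : Rˣ), by simp, ⟨_, rfl⟩,
      ⟨((u * v⁻¹)⁻¹ : Rˣ), hinv _⟩, ?_⟩
    rw [zpow_sub₀ hϖ0, zpow_natCast, zpow_natCast, Units.val_mul, map_mul, map_mul, map_mul,
      map_pow, map_pow, hinv]
    have hv : algebraMap R K v ≠ 0 := by simp
    field_simp

section Localization

variable {B K : Type*} [CommRing B] [IsDomain B]
  [Field K] [Algebra B K] [IsFractionRing B K]

/-- The localization of a domain at a prime ideal, as a subring of the field of fractions. -/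
noncomputable def Ideal.localizationSubring (K : Type*) [Field K] [Algebra B K] [IsFractionRing B K]
    (P : Ideal B) [P.IsPrime] : Subring K :=
  (Localization.subalgebra.ofField K P.primeCompl P.primeCompl_le_nonZeroDivisors).toSubring

theorem Ideal.mem_localizationSubring {P : Ideal B} [P.IsPrime] {x : K} :
    x ∈ P.localizationSubring K ↔
      ∃ a s : B, s ∉ P ∧ x = algebraMap B K a * (algebraMap B K s)⁻¹ := by
  change (∃ (a s : B) (_ : s ∈ P.primeCompl), _) ↔ _
  simp only [exists_prop]
  rfl

/-- If a prime ideal `P` is contained in `b / c` times the ring, with `b ∈ P` and `c ∉ P`, then the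
localization at `P` is a discrete valuation ring. -/
theorem Ideal.exists_isUniformizer_localizationSubring [IsNoetherianRing B]
    {P : Ideal B} [P.IsPrime] {b c : B}
    (hb : b ∈ P) (hc : c ∉ P) (hb0 : b ≠ 0) (h : ∀ y ∈ P, ∃ z, y * c = z * b) :
    ∃ π : K, (P.localizationSubring K).IsUniformizer π := by
  let R := Localization.subalgebra.ofField K P.primeCompl P.primeCompl_le_nonZeroDivisors
  have : IsLocalization.AtPrime R P := Localization.subalgebra.isLocalization_ofField K _ _
  have : IsLocalRing R := IsLocalization.AtPrime.isLocalRing R P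
  have : IsNoetherianRing R := IsLocalization.isNoetherianRing P.primeCompl R inferInstance
  have hinj : Function.Injective (algebraMap B R) := FaithfulSMul.algebraMap_injective B R
  have hmax : IsLocalRing.maximalIdeal R = P.map (algebraMap B R) :=
    (IsLocalization.AtPrime.map_eq_maximalIdeal P R).symm
  have hmap : P.map (algebraMap B R) = Ideal.span {algebraMap B R b} := by
    apply le_antisymm
    · rw [Ideal.map_le_iff_le_comap]
      intro y hy
      obtain ⟨z, hz⟩ := h y hy
      rw [Ideal.mem_comap, Ideal.mem_span_singleton]
      -- In the localization `c` is invertible, so `y * c = z * b` makes `y` a multiple of `b`.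
      have hu : IsUnit (algebraMap B R c) :=
        IsLocalization.map_units R (⟨c, hc⟩ : P.primeCompl)
      rw [← hu.dvd_mul_right, ← map_mul, hz, map_mul]
      exact dvd_mul_left _ _
    · rw [Ideal.span_singleton_le_iff_mem]
      exact Ideal.mem_map_of_mem _ hb
  have hb1 : algebraMap B R b ≠ 0 := by
    rw [← map_zero (algebraMap B R)]; exact hinj.ne hb0
  have hfield : ¬ IsField R := by
    rw [IsLocalRing.isField_iff_maximalIdeal_eq, hmax, hmap, Ideal.span_singleton_eq_bot]
    exact hb1
  have : IsDiscreteValuationRing R :=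
    ((IsDiscreteValuationRing.TFAE R hfield).out 4 0).1
      (by rw [hmax, hmap]; exact ⟨⟨_, rfl⟩⟩)
  obtain ⟨ϖ, hϖ⟩ := IsDiscreteValuationRing.exists_irreducible R
  refine ⟨algebraMap R K ϖ, ?_⟩
  have : P.localizationSubring K = (algebraMap R K).range := by
    ext x
    exact ⟨fun hx => ⟨⟨x, hx⟩, rfl⟩, fun ⟨y, hy⟩ => hy ▸ y.2⟩
  rw [this]
  exact IsDiscreteValuationRing.isUniformizer_range hϖ

/-- Let `u` be a nonzero element of a Noetherian integrally closed domain `B`. There are finitely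
many discrete valuation rings such that `B` is the intersection of `B[1/u]` with them. -/
theorem exists_finite_discrete_valuations [IsNoetherianRing B] [IsIntegrallyClosed B]
    {u : B} (hu : u ≠ 0) :
    ∃ D : Set (Subring K), D.Finite ∧ (∀ A ∈ D, ∃ π, A.IsUniformizer π) ∧
      ∀ (f : K) (n : ℕ), algebraMap B K u ^ n * f ∈ (algebraMap B K).range →
        (∀ A ∈ D, f ∈ A) → f ∈ (algebraMap B K).range := by
  -- The rings are the localizations at those associated primes of `(u)` that turn out to be
  -- discrete valuation rings; discarding the others avoids any discussion of height.
  have hu0 : algebraMap B K u ≠ 0 := by simpa using hu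
  refine ⟨{A | (∃ (P : Ideal B) (_ : P.IsPrime), P ∈ associatedPrimes B (B ⧸ Ideal.span {u}) ∧
    A = P.localizationSubring K) ∧ ∃ π, A.IsUniformizer π}, ?_, fun A hA => hA.2, ?_⟩
  · have : Finite (associatedPrimes B (B ⧸ Ideal.span {u})) := associatedPrimes.finite _ _
    refine Set.Finite.subset (Set.finite_range
      fun P : associatedPrimes B (B ⧸ Ideal.span {u}) => P.1.localizationSubring K) ?_
    rintro A ⟨⟨P, hP, hP', rfl⟩, -⟩
    exact ⟨⟨P, hP'⟩, rfl⟩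
  · intro f n hn hf
    by_contra hfB
    let N : Submodule B K := LinearMap.range (Algebra.linearMap B K)
    have hN : ∀ x, x ∈ N ↔ x ∈ (algebraMap B K).range := fun x => Iff.rfl
    have hf0 : N.mkQ f ≠ 0 := by
      rwa [Ne, Submodule.mkQ_apply, Submodule.Quotient.mk_eq_zero, hN]
    -- An element `f` outside `B` is nonzero in `K / B`, so its annihilator lies in an associated
    -- prime `P`, the annihilator of some class `g`. A power of `u` kills `f`, so `u ∈ P`.
    obtain ⟨P, hP, hle⟩ := exists_le_isAssociatedPrime_of_isNoetherianRing B (N.mkQ f) hf0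
    have hcolon : ∀ (x : K) (b : B), b ∈ (⊥ : Submodule B (K ⧸ N)).colon {N.mkQ x} ↔
        algebraMap B K b * x ∈ (algebraMap B K).range := by
      intro x b
      rw [Submodule.mem_colon_singleton, Submodule.mem_bot, ← map_smul, Submodule.mkQ_apply,
        Submodule.Quotient.mk_eq_zero, hN, Algebra.smul_def]
    rw [isAssociatedPrime_iff] at hP
    obtain ⟨hprime, g', hg'⟩ := hP
    obtain ⟨g, rfl⟩ := N.mkQ_surjective g'
    have hPg : ∀ b, b ∈ P ↔ algebraMap B K b * g ∈ (algebraMap B K).range := fun b => by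
      rw [hg', hcolon]
    have huP : u ∈ P := by
      refine hprime.mem_of_pow_mem n (hle ?_)
      rwa [hcolon, map_pow]
    have hgB : g ∉ (algebraMap B K).range := by
      intro hg
      refine hprime.ne_top ((Ideal.eq_top_iff_one _).2 ((hPg 1).2 ?_))
      rwa [map_one, one_mul]
    have hassoc : P ∈ associatedPrimes B (B ⧸ Ideal.span {u}) := by
      rw [AssociatedPrimes.mem_iff, isAssociatedPrime_iff]
      -- `P` is also the annihilator of the class of `w = u * g` in `B / (u)`.
      obtain ⟨w, hw⟩ := (hPg u).1 huP
      refine ⟨hprime, Ideal.Quotient.mk _ w, ?_⟩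
      ext b
      rw [Submodule.mem_colon_singleton, Submodule.mem_bot, hPg, Algebra.smul_def,
        Ideal.Quotient.algebraMap_eq, ← map_mul, Ideal.Quotient.eq_zero_iff_mem,
        Ideal.mem_span_singleton]
      constructor
      · rintro ⟨z, hz⟩
        refine ⟨z, IsFractionRing.injective B K ?_⟩
        rw [map_mul, map_mul, hw, hz]; ring
      · rintro ⟨z, hz⟩
        refine ⟨z, ?_⟩
        have := congrArg (algebraMap B K) hz
        rw [map_mul, map_mul, hw] at this
        apply mul_left_cancel₀ hu0
        rw [← this]; ring
    -- Otherwise `g` would map the finitely generated nonzero module `P` into itself, hence be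
    -- integral over `B` and lie in `B`.
    have hexists : ∃ b ∈ P, ∃ c ∉ P, algebraMap B K b * g = algebraMap B K c := by
      by_contra! hcon
      apply hgB
      have hint : IsIntegral B g := by
        refine isIntegral_of_smul_mem_submodule (Submodule.map (Algebra.linearMap B K) P)
          ?_ ?_ g ?_
        · rw [Submodule.ne_bot_iff]
          exact ⟨_, ⟨u, huP, rfl⟩, hu0⟩
        · exact Submodule.FG.map _ (IsNoetherian.noetherian P)
        · rintro _ ⟨b, hb, rfl⟩
          obtain ⟨c, hc⟩ := (hPg b).1 hb
          refine ⟨c, ?_, ?_⟩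
          · by_contra hcP
            exact hcon b hb c hcP hc.symm
          · rw [smul_eq_mul, mul_comm]
            exact hc
      exact IsIntegrallyClosed.algebraMap_eq_of_integral hint
    obtain ⟨b, hb, c, hc, hbc⟩ := hexists
    have hb0 : b ≠ 0 := by
      rintro rfl
      rw [map_zero, zero_mul, eq_comm, map_eq_zero_iff _ (IsFractionRing.injective B K)] at hbc
      exact hc (hbc ▸ P.zero_mem)
    have hunif : ∃ π, (P.localizationSubring K).IsUniformizer π := by
      refine Ideal.exists_isUniformizer_localizationSubring hb hc hb0 fun y hy => ?_
      obtain ⟨z, hz⟩ := (hPg y).1 hy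
      refine ⟨z, IsFractionRing.injective B K ?_⟩
      rw [map_mul, map_mul, hz, ← hbc]; ring
    -- Now `f = a / s` with `s ∉ P`, although `s` annihilates the class of `f`, whose annihilator is
    -- inside `P`.
    obtain ⟨a, s, hs, hfa⟩ := Ideal.mem_localizationSubring.1
      (hf _ ⟨⟨P, hprime, hassoc, rfl⟩, hunif⟩)
    refine hs (hle ((hcolon f s).2 ⟨a, ?_⟩))
    have hs0 : algebraMap B K s ≠ 0 := by
      intro h0
      rw [map_eq_zero_iff _ (IsFractionRing.injective B K)] at h0
      exact hs (h0 ▸ P.zero_mem)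
    rw [hfa]; field_simp

end Localization
-- Normal models of a finitely generated field
open IntermediateField in
/-- A Noetherian integrally closed subring `B` of a field can be extended, in finitely many ways,
to Noetherian integrally closed subrings with field of fractions `Frac(B)(x)`, such that every
valuation ring containing `B` contains one of them. -/
theorem Subring.exists_finite_isIntegrallyClosed_extensions {E : Type*} [Field E] [CharZero E]
    (B : Subring E) [IsNoetherianRing B] [IsIntegrallyClosed B] (x : E) :
    ∃ S : Set (Subring E), S.Finite ∧
      (∀ C ∈ S, IsNoetherianRing C ∧ IsIntegrallyClosed C ∧
        Subfield.closure (C : Set E) = Subfield.closure (insert x (B : Set E))) ∧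
      ∀ V : ValuationSubring E, B ≤ V.toSubring → ∃ C ∈ S, C ≤ V.toSubring := by
  by_cases hx : IsAlgebraic B x
  · let K := FractionRing B
    let : Algebra K E := FractionRing.liftAlgebra B E
    have : IsScalarTower B K E := FractionRing.isScalarTower_liftAlgebra B E
    have : CharZero B := ⟨fun m n h => by
      have := congrArg (algebraMap B E) h
      simpa using this⟩
    have : CharZero K := inferInstanceAs (CharZero (FractionRing B))
    have hxK : IsAlgebraic K x := hx.extendScalars (IsFractionRing.injective B K)
    have : FiniteDimensional K K⟮x⟯ := adjoin.finiteDimensional hxK.isIntegral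
    let C := integralClosure B K⟮x⟯
    -- Characteristic zero makes the finite extension separable, so the integral closure is
    -- Noetherian.
    have : IsNoetherianRing C := integralClosure.isNoetherianRing (K := K) K⟮x⟯
    have : IsIntegrallyClosed C := integralClosure.isIntegrallyClosedOfFiniteExtension K
    let f : C →+* E := (algebraMap K⟮x⟯ E).comp (algebraMap C K⟮x⟯)
    have hf : Function.Injective f := fun a b h => Subtype.ext (Subtype.ext h)
    have : IsScalarTower B K⟮x⟯ E := IsScalarTower.of_algebraMap_eq fun b => by
      rw [IsScalarTower.algebraMap_apply B K K⟮x⟯, IsScalarTower.algebraMap_apply B K E,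
        IsScalarTower.algebraMap_apply K K⟮x⟯ E]
    have hmem : ∀ y : E, y ∈ f.range ↔ y ∈ K⟮x⟯ ∧ IsIntegral B y := by
      intro y
      constructor
      · rintro ⟨z, rfl⟩
        exact ⟨z.1.2, z.2.algebraMap⟩
      · rintro ⟨h1, h2⟩
        refine ⟨⟨⟨y, h1⟩, ?_⟩, rfl⟩
        exact (isIntegral_algHom_iff (IsScalarTower.toAlgHom B K⟮x⟯ E)
          (algebraMap K⟮x⟯ E).injective).1 h2
    let e : C ≃+* f.range := RingEquiv.ofBijective f.rangeRestrict
      ⟨fun a b h => hf (congrArg (Subtype.val : f.range → E) h), f.rangeRestrict_surjective⟩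
    have hBle : ∀ b ∈ B, b ∈ f.range := by
      intro b hb
      rw [hmem]
      exact ⟨by
        have := K⟮x⟯.algebraMap_mem (algebraMap B K ⟨b, hb⟩)
        rwa [← IsScalarTower.algebraMap_apply] at this, isIntegral_algebraMap (x := (⟨b, hb⟩ : B))⟩
    refine ⟨{f.range}, Set.finite_singleton _, ?_, ?_⟩
    · rintro _ rfl
      refine ⟨isNoetherianRing_of_ringEquiv C e, IsIntegrallyClosed.of_equiv e, le_antisymm ?_ ?_⟩
      · rw [Subfield.closure_le]
        have hle : K⟮x⟯.toSubfield ≤ Subfield.closure (insert x (B : Set E)) := by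
          change Subfield.closure _ ≤ _
          rw [Subfield.closure_le]
          rintro _ (⟨k, rfl⟩ | rfl)
          · obtain ⟨a, b, -, rfl⟩ := IsFractionRing.div_surjective B k
            rw [map_div₀, ← IsScalarTower.algebraMap_apply, ← IsScalarTower.algebraMap_apply]
            exact div_mem (Subfield.subset_closure (Or.inr a.2))
              (Subfield.subset_closure (Or.inr b.2))
          · exact Subfield.subset_closure (Or.inl rfl)
        intro y hy
        exact hle ((hmem y).1 hy).1
      · rw [Subfield.closure_le]
        rintro y (rfl | hy)
        -- The element `x` need not be integral, but it is the quotient of an integral multiple by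
        -- an element of `B`.
        · obtain ⟨b, hb0, hb⟩ := hx.exists_integral_multiple
          have hb0' : (b : E) ≠ 0 := by simpa using hb0
          have h1 : (b : E) * y ∈ f.range := by
            rw [hmem]
            refine ⟨mul_mem ((hmem _).1 (hBle _ b.2)).1 (mem_adjoin_simple_self K y), hb⟩
          have h2 := div_mem (Subfield.subset_closure h1) (Subfield.subset_closure (hBle _ b.2))
          rwa [mul_div_cancel_left₀ _ hb0'] at h2
        · exact Subfield.subset_closure (hBle y hy)
    · intro V hV
      refine ⟨_, rfl, fun y hy => ?_⟩
      have : IsIntegrallyClosedIn V.toSubring E := inferInstanceAs (IsIntegrallyClosedIn V E)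
      exact Subring.integralClosure_subring_le_iff.2 hV ((hmem y).1 hy).2
  -- In the transcendental case `B[x]` and `B[x⁻¹]` are polynomial rings, and every valuation ring
  -- contains `x` or `x⁻¹`.
  · have key : ∀ y : E, ¬ IsAlgebraic B y →
        IsNoetherianRing (Algebra.adjoin B {y}).toSubring ∧
        IsIntegrallyClosed (Algebra.adjoin B {y}).toSubring := by
      intro y hy
      let e : Polynomial B ≃+* (Algebra.adjoin B {y}).toSubring :=
        ((AlgEquiv.ofInjective (Polynomial.aeval y)
          (transcendental_iff_injective.1 hy)).trans
          (Subalgebra.equivOfEq _ _ (Algebra.adjoin_singleton_eq_range_aeval B y).symm)).toRingEquiv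
      exact ⟨isNoetherianRing_of_ringEquiv _ e, IsIntegrallyClosed.of_equiv e⟩
    have hcl : ∀ y : E, Subfield.closure ((Algebra.adjoin B {y}).toSubring : Set E) =
        Subfield.closure (insert y (B : Set E)) := by
      intro y
      apply le_antisymm
      · rw [Subfield.closure_le]
        intro z hz
        refine Algebra.adjoin_induction (p := fun z _ => z ∈ Subfield.closure (insert y (B : Set E)))
          ?_ ?_ ?_ ?_ hz
        · rintro _ rfl; exact Subfield.subset_closure (Or.inl rfl)
        · intro b; exact Subfield.subset_closure (Or.inr b.2)
        · intro a b _ _ ha hb; exact add_mem ha hb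
        · intro a b _ _ ha hb; exact mul_mem ha hb
      · apply Subfield.closure_mono
        rintro z (rfl | hz)
        · exact Algebra.subset_adjoin rfl
        · exact (Algebra.adjoin B {y}).algebraMap_mem ⟨z, hz⟩
    have hxi : ¬ IsAlgebraic B x⁻¹ := fun h => hx (by simpa using h.inv)
    have hinv : Subfield.closure (insert x⁻¹ (B : Set E)) =
        Subfield.closure (insert x (B : Set E)) := by
      apply le_antisymm <;> rw [Subfield.closure_le]
      · rintro z (rfl | hz)
        · exact inv_mem (Subfield.subset_closure (Or.inl rfl))
        · exact Subfield.subset_closure (Or.inr hz)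
      · rintro z (rfl | hz)
        · exact inv_mem_iff.1 (Subfield.subset_closure (Or.inl rfl))
        · exact Subfield.subset_closure (Or.inr hz)
    refine ⟨{(Algebra.adjoin B {x}).toSubring, (Algebra.adjoin B {x⁻¹}).toSubring},
      Set.toFinite _, ?_, ?_⟩
    · rintro _ (rfl | rfl)
      · exact ⟨(key x hx).1, (key x hx).2, hcl x⟩
      · exact ⟨(key _ hxi).1, (key _ hxi).2, (hcl _).trans hinv⟩
    · intro V hV
      have hle : ∀ y ∈ V, (Algebra.adjoin B {y}).toSubring ≤ V.toSubring := by
        intro y hy z hz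
        refine Algebra.adjoin_induction (p := fun z _ => z ∈ V) ?_ ?_ ?_ ?_ hz
        · rintro _ rfl; exact hy
        · intro b; exact hV b.2
        · intro a b _ _ ha hb; exact add_mem ha hb
        · intro a b _ _ ha hb; exact mul_mem ha hb
      rcases V.mem_or_inv_mem x with h | h
      · exact ⟨_, Or.inl rfl, hle x h⟩
      · exact ⟨_, Or.inr rfl, hle _ h⟩

/-- A finitely generated field of characteristic zero has finitely many Noetherian integrally
closed subrings with the whole field as field of fractions, such that every valuation ring contains
one of them. -/
theorem Subfield.exists_finite_isIntegrallyClosed_models {E : Type*} [Field E] [CharZero E]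
    (X : Finset E) :
    ∃ S : Set (Subring E), S.Finite ∧
      (∀ C ∈ S, IsNoetherianRing C ∧ IsIntegrallyClosed C ∧
        Subfield.closure (C : Set E) = Subfield.closure (X : Set E)) ∧
      ∀ V : ValuationSubring E, ∃ C ∈ S, C ≤ V.toSubring := by
  classical
  induction X using Finset.induction_on with
  | empty =>
    let f : ℤ →+* E := Int.castRingHom E
    let e : ℤ ≃+* f.range := RingEquiv.ofBijective f.rangeRestrict
      ⟨fun a b h => Int.cast_injective (congrArg Subtype.val h), f.rangeRestrict_surjective⟩
    refine ⟨{f.range}, Set.finite_singleton _, ?_, fun V => ⟨_, rfl, ?_⟩⟩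
    · rintro _ rfl
      refine ⟨isNoetherianRing_of_ringEquiv _ e, IsIntegrallyClosed.of_equiv e, ?_⟩
      apply le_antisymm
      · rw [Subfield.closure_le]
        rintro _ ⟨n, rfl⟩
        exact intCast_mem _ n
      · simp [Subfield.closure_empty]
    · rintro _ ⟨n, rfl⟩
      exact intCast_mem V n
  | insert x X _ ih =>
    obtain ⟨S, hS, hS', hV⟩ := ih
    choose! T hT hT' hTV using fun (B : Subring E) (hB : B ∈ S) =>
      have := (hS' B hB).1
      have := (hS' B hB).2.1
      B.exists_finite_isIntegrallyClosed_extensions x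
    refine ⟨⋃ B ∈ S, T B, hS.biUnion hT, ?_, ?_⟩
    · intro C hC
      simp only [Set.mem_iUnion] at hC
      obtain ⟨B, hB, hC⟩ := hC
      refine ⟨(hT' B hB C hC).1, (hT' B hB C hC).2.1, ?_⟩
      rw [(hT' B hB C hC).2.2, Finset.coe_insert, Set.insert_eq, Set.insert_eq,
        Subfield.closure_union, Subfield.closure_union, (hS' B hB).2.2]
    · intro V
      obtain ⟨B, hB, hBV⟩ := hV V
      obtain ⟨C, hC, hCV⟩ := hTV B hB V hBV
      exact ⟨C, Set.mem_biUnion hB hC, hCV⟩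

/-! ### Integrality over ℤ from finitely many discrete valuations -/

/-- The integral closure of ℤ in a field is an intersection of valuation rings. -/
theorem isIntegral_int_of_forall_mem_valuationSubring {E : Type*} [Field E] {x : E}
    (h : ∀ V : ValuationSubring E, x ∈ V) : IsIntegral ℤ x := by
  by_contra hx
  have : IsIntegrallyClosedIn (integralClosure ℤ E).toSubring E :=
    inferInstanceAs (IsIntegrallyClosedIn (integralClosure ℤ E) E)
  obtain ⟨V, -, hV⟩ := Subring.exists_le_valuationSubring_of_isIntegrallyClosedIn
    (R := (integralClosure ℤ E).toSubring) (x := x) hx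
  exact hV (h V)

/-- A finitely generated subring of the field of fractions of a Noetherian integrally closed domain
`C` meets the intersection of finitely many discrete valuation rings inside `C`. -/
theorem Subring.exists_finite_discrete_valuations_of_closure_eq {E : Type*} [Field E]
    (C : Subring E) [IsNoetherianRing C] [IsIntegrallyClosed C] (X : Finset E)
    (hC : Subfield.closure (C : Set E) = Subfield.closure (X : Set E)) :
    ∃ D : Set (Subring (Subfield.closure (X : Set E))), D.Finite ∧
      (∀ A ∈ D, ∃ π, A.IsUniformizer π) ∧
      ∀ r : Subfield.closure (X : Set E), (r : E) ∈ Subring.closure (X : Set E) →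
        (∀ A ∈ D, r ∈ A) → (r : E) ∈ C := by
  classical
  let F := Subfield.closure (X : Set E)
  have hCF : C ≤ F.toSubring := fun c hc => by
    have : c ∈ Subfield.closure (C : Set E) := Subfield.subset_closure hc
    rwa [hC] at this
  let _ : Algebra C F := (Subring.inclusion hCF).toAlgebra
  have hcoe : ∀ c : C, ((algebraMap C F c : F) : E) = c := fun _ => rfl
  have : FaithfulSMul C F := (faithfulSMul_iff_algebraMap_injective C F).2
    fun a b h => Subtype.ext (congrArg (Subtype.val : F → E) h)
  have : IsFractionRing C F := by
    refine IsFractionRing.of_field C F fun z => ?_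
    have hz : (z : E) ∈ Subfield.closure (C : Set E) := hC ▸ z.2
    rw [Subfield.mem_closure_iff, Subring.closure_eq] at hz
    obtain ⟨a, ha, b, hb, hab⟩ := hz
    exact ⟨⟨a, ha⟩, ⟨b, hb⟩, Subtype.ext (by rw [← hab]; rfl)⟩
  have hmem : ∀ r : F, r ∈ (algebraMap C F).range ↔ (r : E) ∈ C := fun r =>
    ⟨fun ⟨c, hc⟩ => hc ▸ c.2, fun h => ⟨⟨r, h⟩, rfl⟩⟩
  -- A common denominator of the generators: every element of the ring generated by `X` lies in
  -- `C[1/u]`.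
  obtain ⟨u, hu⟩ := IsLocalization.exist_integer_multiples (nonZeroDivisors C) X.attach
    fun x : X => (⟨x, Subfield.subset_closure x.2⟩ : F)
  have hu0 : (u : C) ≠ 0 := nonZeroDivisors.ne_zero u.2
  obtain ⟨D, hD, hD', h⟩ := exists_finite_discrete_valuations (B := C) (K := F) hu0
  refine ⟨D, hD, hD', fun r hr hrD => ?_⟩
  have hpow : ∀ (m n : ℕ) (r : E), m ≤ n → ((u : C) : E) ^ m * r ∈ C →
      ((u : C) : E) ^ n * r ∈ C := by
    intro m n r hmn hr
    rw [← Nat.sub_add_cancel hmn, pow_add, mul_assoc]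
    exact mul_mem (pow_mem (u : C).2 _) hr
  obtain ⟨n, hn⟩ : ∃ n : ℕ, ((u : C) : E) ^ n * r ∈ C := by
    clear hrD
    generalize (r : E) = r at hr
    induction hr using Subring.closure_induction with
    | mem x hx =>
      obtain ⟨c, hc⟩ := hu ⟨x, hx⟩ (Finset.mem_attach _ _)
      refine ⟨1, ?_⟩
      rw [pow_one]
      have : ((u : C) : E) * x = c := (congrArg (Subtype.val : F → E) hc).symm
      rw [this]
      exact c.2
    | zero => exact ⟨0, by simp⟩
    | one => exact ⟨0, by simp⟩
    | add x y _ _ hx hy =>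
      obtain ⟨m, hm⟩ := hx
      obtain ⟨n, hn⟩ := hy
      refine ⟨max m n, ?_⟩
      rw [mul_add]
      exact add_mem (hpow _ _ _ (le_max_left m n) hm) (hpow _ _ _ (le_max_right m n) hn)
    | neg x _ hx =>
      obtain ⟨m, hm⟩ := hx
      exact ⟨m, by rw [mul_neg]; exact neg_mem hm⟩
    | mul x y _ _ hx hy =>
      obtain ⟨m, hm⟩ := hx
      obtain ⟨n, hn⟩ := hy
      refine ⟨m + n, ?_⟩
      rw [pow_add, mul_mul_mul_comm]
      exact mul_mem hm hn
  rw [← hmem]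
  exact h r n ((hmem _).2 hn) hrD

/-- In a finitely generated ring of characteristic zero, the elements that are integral at finitely
many suitable discrete valuations are integral over `ℤ`. -/
theorem Subring.exists_list_discrete_valuations {E : Type*} [Field E] [CharZero E]
    (X : Finset E) :
    ∃ D : List (Subring (Subfield.closure (X : Set E))),
      (∀ A ∈ D, ∃ π, A.IsUniformizer π) ∧
      ∀ r : Subfield.closure (X : Set E), (r : E) ∈ Subring.closure (X : Set E) →
        (∀ A ∈ D, r ∈ A) → IsIntegral ℤ (r : E) := by
  obtain ⟨S, hS, hS', hV⟩ := Subfield.exists_finite_isIntegrallyClosed_models X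
  choose! D hD hD' h using fun (C : Subring E) (hC : C ∈ S) =>
    have := (hS' C hC).1
    have := (hS' C hC).2.1
    C.exists_finite_discrete_valuations_of_closure_eq X (hS' C hC).2.2
  have hfin : (⋃ C ∈ S, D C).Finite := hS.biUnion hD
  have hmem : ∀ A, A ∈ hfin.toFinset.toList ↔ ∃ C ∈ S, A ∈ D C := by simp
  refine ⟨hfin.toFinset.toList, fun A hA => ?_, fun r hr hrD => ?_⟩
  · obtain ⟨C, hC, hA⟩ := (hmem A).1 hA
    exact hD' C hC A hA
  · refine isIntegral_int_of_forall_mem_valuationSubring fun V => ?_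
    obtain ⟨C, hC, hCV⟩ := hV V
    exact hCV (h C hC r hr fun A hA => hrD A ((hmem A).2 ⟨C, hC, hA⟩))

/-! ### From valuations to the hierarchy -/

theorem Matrix.SpecialLinearGroup.map_injective {n R S : Type*} [Fintype n] [DecidableEq n]
    [CommRing R] [CommRing S] {f : R →+* S} (hf : Function.Injective f) :
    Function.Injective (Matrix.SpecialLinearGroup.map (n := n) f) := by
  intro a b h
  ext i j
  exact hf (congrArg (fun g : Matrix.SpecialLinearGroup n S => g.1 i j) h)

theorem Matrix.SpecialLinearGroup.trace_map {n R S : Type*} [Fintype n] [DecidableEq n]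
    [CommRing R] [CommRing S] (f : R →+* S) (g : Matrix.SpecialLinearGroup n R) :
    (Matrix.SpecialLinearGroup.map f g).1.trace = f g.1.trace :=
  (AddMonoidHom.map_trace f g.1).symm

/-- A matrix in `SL_n(S)` with entries in the range of `f` comes from `SL_n(R)`. -/
theorem Matrix.SpecialLinearGroup.mem_range_map {n R S : Type*} [Fintype n] [DecidableEq n]
    [CommRing R] [CommRing S] {f : R →+* S} (hf : Function.Injective f)
    {g : Matrix.SpecialLinearGroup n S} (hg : ∀ i j, g.1 i j ∈ f.range) :
    g ∈ (Matrix.SpecialLinearGroup.map (n := n) f).range := by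
  choose M hM using hg
  have hMg : f.mapMatrix (Matrix.of M) = g.1 := by
    ext i j
    exact hM i j
  refine ⟨⟨Matrix.of M, hf ?_⟩, Subtype.ext hMg⟩
  rw [RingHom.map_det, hMg, g.2, map_one]

theorem Matrix.isIntegral_coeff_charpoly_of_isIntegral_trace {M : Matrix (Fin 2) (Fin 2) ℂ}
    (hdet : M.det = 1) (htr : IsIntegral ℤ M.trace) (k : ℕ) :
    IsIntegral ℤ (M.charpoly.coeff k) := by
  rw [Matrix.charpoly_fin_two, hdet]
  match k with
  | 0 => simpa using isIntegral_one
  | 1 => simpa [Polynomial.coeff_X, Polynomial.coeff_one] using htr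
  | 2 => simpa [Polynomial.coeff_X, Polynomial.coeff_one] using isIntegral_one
  | k + 3 => simpa [Polynomial.coeff_X, Polynomial.coeff_one, Polynomial.coeff_X_pow] using
      isIntegral_zero

/-- If the traces of the elements of `Γ` that are integral at all valuations of a list are
algebraic integers, then the level of `Γ` in the hierarchy is at most the length of the list. -/
theorem mem_treeHierarchy_length {K : Type} [Field K] (ι : K →+* ℂ) (D : List (Subring K))
    (hD : ∀ A ∈ D, ∃ π, A.IsUniformizer π) :
    ∀ Γ : Subgroup (Matrix.SpecialLinearGroup (Fin 2) ℂ),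
      Γ ≤ (Matrix.SpecialLinearGroup.map (n := Fin 2) ι).range →
      (∀ g ∈ Γ, ∀ t : K, ι t = g.1.trace → (∀ A ∈ D, t ∈ A) → IsIntegral ℤ g.1.trace) →
      Γ ∈ treeHierarchy D.length := by
  have hι := Matrix.SpecialLinearGroup.map_injective (n := Fin 2) ι.injective
  induction D with
  | nil =>
    intro Γ hΓ h g hg k
    obtain ⟨g', rfl⟩ := hΓ hg
    exact Matrix.isIntegral_coeff_charpoly_of_isIntegral_trace
      (Matrix.SpecialLinearGroup.map ι g').2
      (h _ hg _ (Matrix.SpecialLinearGroup.trace_map ι g').symm (by simp)) k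
  | cons A D ih =>
    intro Γ hΓ h
    obtain ⟨π, hπ⟩ := hD A List.mem_cons_self
    let φ : Γ →* Matrix.SpecialLinearGroup (Fin 2) K :=
      (MonoidHom.ofInjective hι).symm.toMonoidHom.comp (Subgroup.inclusion hΓ)
    have hφ : ∀ g : Γ, Matrix.SpecialLinearGroup.map ι (φ g) = g := fun g =>
      congrArg Subtype.val ((MonoidHom.ofInjective hι).apply_symm_apply (Subgroup.inclusion hΓ g))
    obtain ⟨V, T, act, hT, hadj, hinv, hstab⟩ := exists_tree_of_isUniformizer hπ φ
    refine ⟨V, T, act, hT, hadj, hinv, fun v => ?_⟩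
    -- The stabilizer need not be finitely generated; the induction only needs it to lie in SL₂(K)
    -- and to have traces in `A`, so that the condition at `A` can be dropped.
    refine ih (fun B hB => hD B (List.mem_cons_of_mem _ hB)) _ ?_ ?_
    · rintro _ ⟨g, -, rfl⟩
      exact hΓ g.2
    · rintro _ ⟨g, hg, rfl⟩ t ht htD
      refine h g g.2 t ht ?_
      rw [List.forall_mem_cons]
      refine ⟨?_, htD⟩
      have : t = (φ g).1.trace := by
        apply ι.injective
        rw [ht, ← Matrix.SpecialLinearGroup.trace_map, hφ]
        rfl
      rw [this]
      exact hstab v g hg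

theorem mainTheorem6 (Γ : Subgroup (Matrix.SpecialLinearGroup (Fin 2) ℂ)) (hΓ : Γ.FG) :
    Γ ∈ ⋃ i : ℕ, treeHierarchy i := by
  classical
  obtain ⟨S, rfl⟩ := hΓ
  let X : Finset ℂ := S.biUnion fun g => Finset.univ.image fun p : Fin 2 × Fin 2 => g.1 p.1 p.2
  let R := Subring.closure (X : Set ℂ)
  let F := Subfield.closure (X : Set ℂ)
  have hX : ∀ g ∈ S, ∀ i j, g.1 i j ∈ (X : Set ℂ) := fun g hg i j =>
    Finset.mem_biUnion.2 ⟨g, hg, Finset.mem_image.2 ⟨(i, j), Finset.mem_univ _, rfl⟩⟩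
  have hR : Subgroup.closure (S : Set (Matrix.SpecialLinearGroup (Fin 2) ℂ)) ≤
      (Matrix.SpecialLinearGroup.map (n := Fin 2) R.subtype).range := by
    rw [Subgroup.closure_le]
    intro g hg
    exact Matrix.SpecialLinearGroup.mem_range_map R.subtype_injective fun i j =>
      ⟨⟨_, Subring.subset_closure (hX g hg i j)⟩, rfl⟩
  have hF : Subgroup.closure (S : Set (Matrix.SpecialLinearGroup (Fin 2) ℂ)) ≤
      (Matrix.SpecialLinearGroup.map (n := Fin 2) F.subtype).range := by
    rw [Subgroup.closure_le]
    intro g hg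
    exact Matrix.SpecialLinearGroup.mem_range_map F.subtype.injective fun i j =>
      ⟨⟨_, Subfield.subset_closure (hX g hg i j)⟩, rfl⟩
  obtain ⟨D, hD, h⟩ := Subring.exists_list_discrete_valuations X
  refine Set.mem_iUnion.2 ⟨_, mem_treeHierarchy_length F.subtype D hD _ hF ?_⟩
  intro g hg t ht htD
  have ht' : (t : ℂ) = g.1.trace := ht
  rw [← ht']
  refine h t ?_ htD
  -- The trees need the field `F`, but the integrality criterion applies only to elements of `R`;
  -- the whole group has its entries, and so its traces, there.
  obtain ⟨g', rfl⟩ := hR hg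
  rw [ht', Matrix.SpecialLinearGroup.trace_map]
  exact Subtype.prop _
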